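/- Let $K$ be a field. For a finite simple graph $G$ on a vertex set $V$ with $|V|=n$, let $J_G$ be its binomial edge ideal in $S_G=K[x_i,y_i : i\in V]$, generated by $x_iy_j-x_jy_i$ for all edges $\{i,j\}$ of $G$. For $T\subseteq V$ let $P_T(G)\subseteq S_G$ be the ideal generated by the variables $x_i,y_i$ with $i\in T$ together with the binomials $x_iy_j-x_jy_i$ for all pairs of distinct vertices $i,j$ lying in the same connected component of the induced subgraph $G_{V\setminus T}$. A vertex $v$ of a graph is a cut point if deleting $v$ yields a graph with more connected components. Let $\mathcal C(G)$ consist of $\emptyset$ and of all $T\subseteq V$ such that every $i\in T$ is a cut point of the induced subgraph $G_{(V\setminus T)\cup\{i\}}$; put $\overline{\mathcal C}(G)=\mathcal C(G)\setminus\{\emptyset\}$. For collections $\mathcal A,\mathcal B$ of sets, let $\mathcal A\circ\mathcal B=\{A\cup B: A\in\mathcal A,\ B\in\mathcal B\}$. The join $G_1*G_2$ of graphs on disjoint vertex sets $V_1,V_2$ is the graph on $V_1\cup V_2$ whose edges are those of $G_1$, those of $G_2$, and all $\{v,w\}$ with $v\in V_1$, $w\in V_2$. Let $G_1$ and $G_2$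 be connected finite simple graphs on disjoint vertex sets $[n_1]$ and $[n_2]$ with $n_1,n_2\ge 1$ elements, respectively, and let $S=S_{G_1*G_2}$, $S_1=S_{G_1}$, $S_2=S_{G_2}$. Then (a) $\mathcal C(G_1*G_2)=\{\emptyset\}\cup\big(\overline{\mathcal C}(G_1)\circ\{[n_2]\}\big)\cup\big(\overline{\mathcal C}(G_2)\circ\{[n_1]\}\big)$; (b) $\operatorname{height} J_{G_1*G_2}=\min\{\operatorname{height}P_{T_1}(G_1)+2n_2,\ \operatorname{height}P_{T_2}(G_2)+2n_1,\ n_1+n_2-1 : T_1\in\overline{\mathcal C}(G_1),\ T_2\in\overline{\mathcal C}(G_2)\}$; (c) $\dim S/J_{G_1*G_2}=\max\{\dim S_1/P_{T_1}(G_1),\ \dim S_2/P_{T_2}(G_2),\ n_1+n_2+1 : T_1\in\overline{\mathcal C}(G_1),\ T_2\in\overline{\mathcal C}(G_2)\}$. In (b) and (c), the minimum and maximum are over the set of all the listed numbers; if $\overline{\mathcal C}(G_i)$ is empty, the terms indexed by $T_i$ are absent. -/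

import Mathlib

namespace BinomialEdge

/-- The join `G₁ * G₂` of two graphs on disjoint vertex sets: all edges of `G₁`, all edges of `G₂`,
and all edges between a vertex of `G₁` and a vertex of `G₂`. -/
def join {V₁ V₂ : Type*} (G₁ : SimpleGraph V₁) (G₂ : SimpleGraph V₂) : SimpleGraph (V₁ ⊕ V₂) where
  Adj
    | Sum.inl u, Sum.inl v => G₁.Adj u v
    | Sum.inr u, Sum.inr v => G₂.Adj u v
    | Sum.inl _, Sum.inr _ => True
    | Sum.inr _, Sum.inl _ => True
  symm := ⟨by
    rintro (u | u) (v | v) h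
    · exact h.symm
    · trivial
    · trivial
    · exact h.symm⟩
  loopless := ⟨by
    rintro (u | u) h
    · exact G₁.irrefl h
    · exact G₂.irrefl h⟩

/-- A vertex `v` of a (finite) graph is a cut point if deleting it yields a graph with more
connected components. -/
def IsCutPoint {V : Type*} (G : SimpleGraph V) (v : V) : Prop :=
  Nat.card G.ConnectedComponent < Nat.card (G.induce ({v}ᶜ : Set V)).ConnectedComponent

/-- `T` has the cut point property for `G`: each `i ∈ T` is a cut point of the subgraph induced on
`([n] \ T) ∪ {i}`. -/
def HasCutPointProperty {V : Type*} (G : SimpleGraph V) (T : Set V) : Prop :=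
  ∀ i ∈ T, IsCutPoint (G.induce (Tᶜ ∪ {i})) ⟨i, Or.inr rfl⟩

/-- The collection `𝒞(G)`. -/
def cutSets {V : Type*} (G : SimpleGraph V) : Set (Set V) :=
  {∅} ∪ {T | HasCutPointProperty G T}

/-- The collection `𝒞(G) \ {∅}`. -/
def cutSetsBar {V : Type*} (G : SimpleGraph V) : Set (Set V) :=
  cutSets G \ {∅}

/-- The join `𝒜 ∘ ℬ = {A ∪ B : A ∈ 𝒜, B ∈ ℬ}` of two collections of subsets. -/
def familyJoin {V : Type*} (A B : Set (Set V)) : Set (Set V) :=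
  Set.image2 (fun a b => a ∪ b) A B

/-- The polynomial ring `K[x_i, y_i : i ∈ V]`. -/
abbrev PolyRing (K : Type*) [Field K] (V : Type*) : Type _ :=
  MvPolynomial (Fin 2 × V) K

noncomputable section

/-- The variable `x_i`. -/
def x (K : Type*) [Field K] {V : Type*} (i : V) : PolyRing K V := MvPolynomial.X (0, i)

/-- The variable `y_i`. -/
def y (K : Type*) [Field K] {V : Type*} (i : V) : PolyRing K V := MvPolynomial.X (1, i)

/-- The binomial edge ideal `J_G`, generated by `x_i y_j - x_j y_i` for the edges `{i, j}` of `G`.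
Both orientations of an edge are listed; they give the same generator up to sign. -/
def edgeIdeal (K : Type*) [Field K] {V : Type*} (G : SimpleGraph V) : Ideal (PolyRing K V) :=
  Ideal.span {f | ∃ i j : V, G.Adj i j ∧ f = x K i * y K j - x K j * y K i}

/-- The ideal `P_T(G)`, generated by the `x_i, y_i` with `i ∈ T` and the binomial edge ideals of the
complete graphs on the vertex sets of the connected components of the subgraph induced on the
complement of `T`. -/
def primeIdeal (K : Type*) [Field K] {V : Type*} (G : SimpleGraph V) (T : Set V) :
    Ideal (PolyRing K V) :=
  Ideal.span (⋃ i ∈ T, {x K i, y K i}) ⊔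
    ⨆ c : (G.induce Tᶜ).ConnectedComponent,
      edgeIdeal K (⊤ : SimpleGraph (Subtype.val '' c.supp : Set V)).spanningCoe

end

end BinomialEdge

/-! Let c(T) be the number of components left after deleting T. The numerical input is height P_T =
|T| + n - c(T) and dim S/P_T = n - |T| + c(T) (`exists_height_primeIdeal_eq`). Parametrize x_i = s_i
a_c, y_i = s_i b_c with c the component of i, and send the variables of T to 0. The kernel contains
P_T and lies in every prime over P_T, so it has the height and coheight of P_T without P_T having to
be shown prime. It also lies on a chain of 2n strict inclusions of similar kernels; as dim S = 2n,
the chain fixes both numbers.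

A prime over J_G contains P_T for T the set of vertices both of whose variables it contains.
Dropping from T a vertex that is not a cut point does not lower c(T), so the least height and
greatest dimension occur at cut sets (`exists_cutSet_height_le`).

If both sides of a join keep a vertex, what remains is connected. Hence a nonempty cut set contains
one whole side and restricts to a nonempty cut set on the other (`mem_cutSetsBar_join_iff`); the two
formulas then give the minimum and the maximum. -/

namespace BinomialEdge

open MvPolynomial

/-! ### Pinning heights by long chains -/

/-- There are at least `k` strict steps from `p` up to `q`, as seen by heights and coheights. -/
def GapAtLeast {α : Type*} [Preorder α] (k : ℕ) (p q : α) : Prop :=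
  Order.height p + k ≤ Order.height q ∧ Order.coheight q + k ≤ Order.coheight p

namespace GapAtLeast

variable {α : Type*} [Preorder α] {p q r : α} {k l : ℕ}

theorem refl (p : α) : GapAtLeast 0 p p := by simp [GapAtLeast]

theorem of_lt (h : p < q) : GapAtLeast 1 p q :=
  ⟨by simpa using Order.height_add_one_le h, by simpa using Order.coheight_add_one_le h⟩

theorem trans (h : GapAtLeast k p q) (h' : GapAtLeast l q r) : GapAtLeast (k + l) p r := by
  constructor
  · calc Order.height p + ((k + l : ℕ) : ℕ∞) = Order.height p + k + l := by push_cast; ring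
      _ ≤ Order.height q + l := by gcongr; exact h.1
      _ ≤ _ := h'.1
  · calc Order.coheight r + ((k + l : ℕ) : ℕ∞) = Order.coheight r + l + k := by push_cast; ring
      _ ≤ Order.coheight q + k := by gcongr; exact h'.2
      _ ≤ _ := h.2

/-- A chain of maximal length pins the height and the coheight of each of its members. -/
theorem height_eq_and_coheight_eq (h : GapAtLeast k p q) (h' : GapAtLeast l q r)
    (hdim : Order.krullDim α = ((k + l : ℕ) : WithBot ℕ∞)) :
    Order.height q = k ∧ Order.coheight q = l := by
  have : Nonempty α := ⟨p⟩
  have hk : (k : ℕ∞) ≤ Order.height q := le_trans le_add_self h.1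
  have hl : (l : ℕ∞) ≤ Order.coheight q := le_trans le_add_self h'.2
  -- The Krull dimension bounds height plus coheight, so the two lower bounds must be equalities.
  have hs : Order.height q + Order.coheight q ≤ ((k + l : ℕ) : ℕ∞) := by
    have h1 := Order.krullDim_eq_iSup_height_add_coheight_of_nonempty (α := α)
    rw [hdim] at h1
    have h2 : ((k + l : ℕ) : ℕ∞) = ⨆ a : α, Order.height a + Order.coheight a := by
      exact_mod_cast h1
    rw [h2]
    exact le_iSup (fun a : α => Order.height a + Order.coheight a) q
  generalize Order.height q = a at *
  generalize Order.coheight q = b at *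
  have ha : a ≠ ⊤ := by rintro rfl; simp at hs
  have hb : b ≠ ⊤ := by rintro rfl; simp at hs
  lift a to ℕ using ha
  lift b to ℕ using hb
  norm_cast at *
  omega

end GapAtLeast

/-! ### Parametrized primes and a chain of length 2n -/

section Parametrization

variable (K : Type*) [Field K] {V : Type*}

open Classical in
/-- The label of the block of `i` once the vertices of `U` have been merged into their
representatives under `r`. -/
noncomputable def blockLabel (r : V → V) (U : Finset V) (i : V) : V := if i ∈ U then r i else i

open Classical in
/-- The parametrization `x_i ↦ s_i a_c`, `y_i ↦ s_i b_c` with `c` the block of `i`, specialized by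
`s_i = 0` for `i ∈ A` and `b_c = 0` for `c ∈ B`. -/
noncomputable def param (r : V → V) (U B A : Finset V) :
    PolyRing K V →ₐ[K] MvPolynomial (Fin 3 × V) K :=
  aeval fun p => (if p.2 ∈ A then 0 else X (0, p.2)) *
    if p.1 = 0 then X (1, blockLabel r U p.2)
    else if blockLabel r U p.2 ∈ B then 0 else X (2, blockLabel r U p.2)

variable {K}

open Classical in
theorem param_x (r : V → V) (U B A : Finset V) (i : V) :
    param K r U B A (x K i) = (if i ∈ A then 0 else X (0, i)) * X (1, blockLabel r U i) := by
  simp [param, x]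

open Classical in
theorem param_y (r : V → V) (U B A : Finset V) (i : V) :
    param K r U B A (y K i) = (if i ∈ A then 0 else X (0, i)) *
      if blockLabel r U i ∈ B then 0 else X (2, blockLabel r U i) := by
  simp [param, y]

theorem algHom_ext_xy {R : Type*} [CommSemiring R] [Algebra K R] {f g : PolyRing K V →ₐ[K] R}
    (hx : ∀ i, f (x K i) = g (x K i)) (hy : ∀ i, f (y K i) = g (y K i)) : f = g := by
  refine MvPolynomial.algHom_ext fun p => ?_
  obtain ⟨k, i⟩ := p
  fin_cases k
  · exact hx i
  · exact hy i

variable (K) in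
/-- The kernel of `param`, as a point of the prime spectrum. -/
noncomputable def paramPrime (r : V → V) (U B A : Finset V) : PrimeSpectrum (PolyRing K V) :=
  ⟨RingHom.ker (param K r U B A), RingHom.ker_isPrime _⟩

/-- A specialization `ψ` of the parameters enlarges the kernel; `f` witnesses strictness. -/
theorem paramPrime_lt {r : V → V} {U B A U' B' A' : Finset V}
    (ψ : MvPolynomial (Fin 3 × V) K →ₐ[K] MvPolynomial (Fin 3 × V) K)
    (hψ : ψ.comp (param K r U B A) = param K r U' B' A') (f : PolyRing K V)
    (hf : param K r U B A f ≠ 0) (hf' : param K r U' B' A' f = 0) :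
    paramPrime K r U B A < paramPrime K r U' B' A' := by
  rw [← PrimeSpectrum.asIdeal_lt_asIdeal]
  refine lt_of_le_of_ne (fun g hg => ?_) fun h => hf ?_
  · change param K r U' B' A' g = 0
    rw [← hψ, AlgHom.comp_apply, show param K r U B A g = 0 from hg, map_zero]
  · have : f ∈ (paramPrime K r U B A).asIdeal := by rw [h]; exact hf'
    exact this

open Classical in
theorem paramPrime_lt_insert_killed (r : V → V) (U B : Finset V) {A : Finset V} {i : V}
    (hi : i ∉ A) : paramPrime K r U B A < paramPrime K r U B (insert i A) := by
  refine paramPrime_lt (aeval fun p => if p = (0, i) then 0 else X p)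
    (algHom_ext_xy (fun j => ?_) fun j => ?_) (x K i) ?_ ?_
  · simp only [AlgHom.comp_apply, param_x]
    by_cases h : j ∈ A <;> by_cases h' : j = i <;> simp_all
  · simp only [AlgHom.comp_apply, param_y]
    by_cases h : j ∈ A <;> by_cases h' : j = i <;> by_cases h'' : blockLabel r U j ∈ B <;> simp_all
  · simp [param_x, hi, X_ne_zero]
  · simp [param_x]

open Classical in
theorem paramPrime_lt_insert_flat (r : V → V) {U B A : Finset V} {i : V}
    (hA : i ∉ A) (hB : i ∉ B) (hU : blockLabel r U i = i) :
    paramPrime K r U B A < paramPrime K r U (insert i B) A := by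
  refine paramPrime_lt (aeval fun p => if p = (2, i) then 0 else X p)
    (algHom_ext_xy (fun j => ?_) fun j => ?_) (y K i) ?_ ?_
  · simp only [AlgHom.comp_apply, param_x]
    by_cases h : j ∈ A <;> simp_all
  · simp only [AlgHom.comp_apply, param_y]
    by_cases h : j ∈ A <;> by_cases h' : blockLabel r U j = i <;>
      by_cases h'' : blockLabel r U j ∈ B <;> simp_all
  · simp [param_y, hA, hB, hU, X_ne_zero]
  · simp [param_y, hU]

open Classical in
-- Identify a_i, b_i with the parameters of the block of `r i`; the minor of `i` and `r i` is the
-- new kernel element.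
theorem paramPrime_lt_insert_merged {r : V → V} {U B A : Finset V} {i : V}
    (hU : ∀ j ∈ insert i U, r j ∉ insert i U) (hi : i ∉ U) (hA : i ∉ A) (hB : i ∉ B)
    (hrA : r i ∉ A) (hrB : r i ∉ B) :
    paramPrime K r U B A < paramPrime K r (insert i U) B A := by
  have hri : r i ∉ insert i U := hU i (Finset.mem_insert_self _ _)
  have hne : r i ≠ i := fun h => hri (by rw [h]; exact Finset.mem_insert_self _ _)
  have hrU : r i ∉ U := fun h => hri (Finset.mem_insert_of_mem h)
  -- Representatives are never merged, so before the step only `i` itself carries the label `i`.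
  have key : ∀ j, (j = i ∧ blockLabel r U j = i ∧ blockLabel r (insert i U) j = r i) ∨
      (blockLabel r U j ≠ i ∧ blockLabel r (insert i U) j = blockLabel r U j) := by
    intro j
    by_cases hj : j = i
    · left; subst hj; simp [blockLabel, hi]
    · right
      by_cases hjU : j ∈ U
      · have := hU j (Finset.mem_insert_of_mem hjU)
        simp only [Finset.mem_insert, not_or] at this
        simp [blockLabel, hjU, this.1]
      · simp [blockLabel, hjU, hj]
  refine paramPrime_lt (aeval fun p => if p.1 ≠ 0 ∧ p.2 = i then X (p.1, r i) else X p)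
    (algHom_ext_xy (fun j => ?_) fun j => ?_) (x K i * y K (r i) - x K (r i) * y K i) ?_ ?_
  · simp only [AlgHom.comp_apply, param_x]
    rcases key j with ⟨h1, h2, h3⟩ | ⟨h1, h2⟩
    · rw [h2, h3]; by_cases h : j ∈ A <;> simp [h]
    · rw [h2]; by_cases h : j ∈ A <;> simp [h, h1]
  · simp only [AlgHom.comp_apply, param_y]
    rcases key j with ⟨h1, h2, h3⟩ | ⟨h1, h2⟩
    · rw [h2, h3]; by_cases h : j ∈ A <;> simp [h, hB, hrB]
    · rw [h2]; by_cases h : j ∈ A <;> by_cases h' : blockLabel r U j ∈ B <;> simp [h, h1, h']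
  · have e1 : blockLabel r U i = i := by simp [blockLabel, hi]
    have e2 : blockLabel r U (r i) = r i := by simp [blockLabel, hrU]
    simp only [map_sub, map_mul, param_x, param_y, e1, e2, hA, hB, hrA, hrB, if_false]
    intro h
    -- With b_i = 0 and every other parameter 1, the minor takes the value 1.
    have := congrArg (MvPolynomial.eval fun p : Fin 3 × V =>
      if p = (2, i) then (0 : K) else 1) h
    simp [hne] at this
  · have e1 : blockLabel r (insert i U) i = r i := by simp [blockLabel]
    have e2 : blockLabel r (insert i U) (r i) = r i := by
      rw [blockLabel, if_neg hri]
    simp only [map_sub, map_mul, param_x, param_y, e1, e2, hA, hrA, hrB, if_false]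
    ring

theorem gap_merge {r : V → V} {T : Finset V} (N : Finset V)
    (hN : ∀ i ∈ N, i ∉ T ∧ r i ∉ T ∧ r i ∉ N) :
    GapAtLeast N.card (paramPrime K r ∅ T T) (paramPrime K r N T T) := by
  classical
  suffices ∀ U ⊆ N, GapAtLeast U.card (paramPrime K r ∅ T T) (paramPrime K r U T T) from
    this N subset_rfl
  intro U
  induction U using Finset.induction_on with
  | empty => intro _; simpa using GapAtLeast.refl _
  | insert i U hi ih =>
    intro hUN
    have hiN : i ∈ N := hUN (Finset.mem_insert_self _ _)
    rw [Finset.card_insert_of_notMem hi]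
    refine (ih fun j hj => hUN (Finset.mem_insert_of_mem hj)).trans (GapAtLeast.of_lt ?_)
    exact paramPrime_lt_insert_merged (fun j hj h => (hN j (hUN hj)).2.2 (hUN h)) hi
      (hN i hiN).1 (hN i hiN).1 (hN i hiN).2.1 (hN i hiN).2.1

/-- Before any merging each block is a single vertex, so each vertex of `T` yields two steps: b_i =
0, then s_i = 0. -/
theorem gap_kill_unmerged (r : V → V) (T : Finset V) :
    GapAtLeast (2 * T.card) (paramPrime K r ∅ ∅ ∅) (paramPrime K r ∅ T T) := by
  classical
  induction T using Finset.induction_on with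
  | empty => simpa using GapAtLeast.refl _
  | insert i T hi ih =>
    rw [Finset.card_insert_of_notMem hi, mul_add]
    refine ih.trans (GapAtLeast.trans (k := 1) (l := 1) (q := paramPrime K r ∅ (insert i T) T) ?_ ?_)
    · exact GapAtLeast.of_lt (paramPrime_lt_insert_flat r hi hi (by simp [blockLabel]))
    · exact GapAtLeast.of_lt (paramPrime_lt_insert_killed r _ _ hi)

open Classical in
theorem gap_flatten {r : V → V} {U T : Finset V} (C : Finset V) (hCU : Disjoint C U)
    (hCT : Disjoint C T) :
    GapAtLeast C.card (paramPrime K r U T T) (paramPrime K r U (C ∪ T) T) := by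
  induction C using Finset.induction_on with
  | empty => simpa using GapAtLeast.refl _
  | insert i C hi ih =>
    rw [Finset.disjoint_insert_left] at hCU hCT
    rw [Finset.card_insert_of_notMem hi, Finset.insert_union]
    refine (ih hCU.2 hCT.2).trans (GapAtLeast.of_lt ?_)
    exact paramPrime_lt_insert_flat r hCT.1 (by simp [hi, hCT.1]) (by simp [blockLabel, hCU.1])

open Classical in
theorem gap_kill {r : V → V} {U B T : Finset V} (C : Finset V) (hCT : Disjoint C T) :
    GapAtLeast C.card (paramPrime K r U B T) (paramPrime K r U B (C ∪ T)) := by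
  induction C using Finset.induction_on with
  | empty => simpa using GapAtLeast.refl _
  | insert i C hi ih =>
    rw [Finset.disjoint_insert_left] at hCT
    rw [Finset.card_insert_of_notMem hi, Finset.insert_union]
    refine (ih hCT.2).trans (GapAtLeast.of_lt ?_)
    exact paramPrime_lt_insert_killed r _ _ (by simp [hi, hCT.1])

/-- Below the point: 2|T| steps deleting `T` and |N| mergers. Above it: |C| steps b_c = 0, one per
representative, then |N| + |C| steps s_i = 0. The total is 2n, the dimension of the ring. -/
theorem height_paramPrime_and_coheight_paramPrime [Fintype V] {r : V → V} {T N C : Finset V}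
    (hN : ∀ i ∈ N, i ∉ T ∧ r i ∉ T ∧ r i ∉ N) (hCN : Disjoint C N) (hCT : Disjoint C T)
    (hcard : T.card + N.card + C.card = Fintype.card V) :
    Order.height (paramPrime K r N T T) = (2 * T.card + N.card : ℕ) ∧
      Order.coheight (paramPrime K r N T T) = (N.card + 2 * C.card : ℕ) := by
  classical
  have h1 := (gap_kill_unmerged (K := K) r T).trans (gap_merge N hN)
  have hdis : Disjoint (N ∪ C) T := by
    rw [Finset.disjoint_union_left]
    exact ⟨Finset.disjoint_left.2 fun i hi => (hN i hi).1, hCT⟩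
  have h2 := (gap_flatten (K := K) (r := r) C hCN hCT).trans
    (gap_kill (U := N) (B := C ∪ T) (N ∪ C) hdis)
  rw [Finset.card_union_of_disjoint hCN.symm] at h2
  have := h1.height_eq_and_coheight_eq h2 (by
    change ringKrullDim (PolyRing K V) = _
    rw [MvPolynomial.ringKrullDim_of_isNoetherianRing, ringKrullDim_eq_zero_of_field, zero_add]
    congr 2
    simp only [Nat.card_eq_fintype_card, Fintype.card_prod, Fintype.card_fin]
    omega)
  refine ⟨this.1, this.2.trans ?_⟩
  congr 1
  omega

end Parametrization

end BinomialEdge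
namespace BinomialEdge

open MvPolynomial

/-! ### Components after deleting a vertex set -/

section Graph

variable {V : Type*} (G : SimpleGraph V)

/-- The number of connected components of the graph after deleting `T`. -/
noncomputable def numComponents (T : Set V) : ℕ := Nat.card (G.induce Tᶜ).ConnectedComponent

/-- `i` and `j` lie in the same connected component after deleting `T`. -/
def SameComponent (T : Set V) (i j : V) : Prop :=
  ∃ (hi : i ∉ T) (hj : j ∉ T), (G.induce Tᶜ).Reachable ⟨i, hi⟩ ⟨j, hj⟩

variable {G} in
theorem SameComponent.induction {T : Set V} {i j : V} (h : SameComponent G T i j) {P : V → Prop}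
    (refl : P i) (step : ∀ a b, a ∉ T → b ∉ T → G.Adj a b → P a → P b) : P j := by
  obtain ⟨hi, hj, h⟩ := h
  rw [SimpleGraph.reachable_iff_reflTransGen] at h
  suffices ∀ b : (Tᶜ : Set V), Relation.ReflTransGen (G.induce Tᶜ).Adj ⟨i, hi⟩ b → P b from
    this _ h
  intro b hb
  induction hb with
  | refl => exact refl
  | @tail b c _ hbc ih => exact step b c b.2 c.2 hbc ih

theorem exists_representative (T : Set V) [Finite V] :
    ∃ r : V → V, (∀ i ∉ T, SameComponent G T (r i) i) ∧
      (∀ i j, SameComponent G T i j → r i = r j) ∧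
      {i | i ∉ T ∧ r i = i}.ncard = numComponents G T := by
  classical
  let m : (Tᶜ : Set V) → (G.induce Tᶜ).ConnectedComponent := (G.induce Tᶜ).connectedComponentMk
  have hm : ∀ c, m c.out = c := fun c => Quot.out_eq c
  -- The value on `T` is arbitrary: every conclusion concerns vertices outside `T`.
  let r : V → V := fun i => if h : i ∈ T then i else (m ⟨i, h⟩).out
  have hr : ∀ i (h : i ∉ T), r i = (m ⟨i, h⟩).out := fun i h => dif_neg h
  have hsame : ∀ i ∉ T, SameComponent G T (r i) i := by
    intro i hi
    rw [hr i hi]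
    exact ⟨(m ⟨i, hi⟩).out.2, hi, SimpleGraph.ConnectedComponent.exact (hm _)⟩
  have heq : ∀ i j, SameComponent G T i j → r i = r j := by
    rintro i j ⟨hi, hj, h⟩
    rw [hr i hi, hr j hj, show m ⟨i, hi⟩ = m ⟨j, hj⟩ from SimpleGraph.ConnectedComponent.sound h]
  refine ⟨r, hsame, heq, ?_⟩
  rw [numComponents, ← Nat.card_coe_set_eq]
  refine Nat.card_congr
    { toFun := fun i => m ⟨i.1, i.2.1⟩
      invFun := fun c => ⟨c.out, c.out.2, ?_⟩
      left_inv := ?_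
      right_inv := fun c => hm c }
  · rw [hr _ c.out.2]
    exact congrArg (fun d : (G.induce Tᶜ).ConnectedComponent => (d.out : V)) (hm c)
  · intro i
    refine Subtype.ext ?_
    exact (hr _ i.2.1).symm.trans i.2.2

end Graph

/-! ### The ideals P_T, their heights and dimensions -/

section Ideals

variable {K : Type*} [Field K] {V : Type*} {G : SimpleGraph V} {T : Set V}

theorem edgeIdeal_le_iff {I : Ideal (PolyRing K V)} :
    edgeIdeal K G ≤ I ↔ ∀ i j, G.Adj i j → x K i * y K j - x K j * y K i ∈ I := by
  rw [edgeIdeal, Ideal.span_le]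
  constructor
  · exact fun h i j hij => h ⟨i, j, hij, rfl⟩
  · rintro h _ ⟨i, j, hij, rfl⟩
    exact h i j hij

theorem primeIdeal_le_iff {I : Ideal (PolyRing K V)} :
    primeIdeal K G T ≤ I ↔ (∀ i ∈ T, x K i ∈ I ∧ y K i ∈ I) ∧
      ∀ i j, SameComponent G T i j → x K i * y K j - x K j * y K i ∈ I := by
  rw [primeIdeal, sup_le_iff, iSup_le_iff, Ideal.span_le]
  refine and_congr ?_ ?_
  · constructor
    · intro h i hi
      exact ⟨h (Set.mem_biUnion hi (Set.mem_insert _ _)),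
        h (Set.mem_biUnion hi (Set.mem_insert_of_mem _ rfl))⟩
    · intro h f hf
      simp only [Set.mem_iUnion] at hf
      obtain ⟨i, hi, rfl | rfl⟩ := hf
      · exact (h i hi).1
      · exact (h i hi).2
  · simp only [edgeIdeal_le_iff]
    constructor
    · rintro h i j ⟨hi, hj, hij⟩
      by_cases hne : i = j
      · subst hne; rw [sub_self]; exact I.zero_mem
      · refine h ((G.induce Tᶜ).connectedComponentMk ⟨i, hi⟩) i j ?_
        simp only [SimpleGraph.map_adj, SimpleGraph.top_adj]
        refine ⟨⟨i, ⟨i, hi⟩, rfl, rfl⟩, ⟨j, ⟨j, hj⟩, ?_, rfl⟩, ?_, rfl, rfl⟩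
        · exact SimpleGraph.ConnectedComponent.sound hij.symm
        · exact fun h => hne (congrArg Subtype.val h)
    · rintro h c i j hij
      simp only [SimpleGraph.map_adj] at hij
      obtain ⟨⟨_, ⟨i, hi⟩, hic, rfl⟩, ⟨_, ⟨j, hj⟩, hjc, rfl⟩, -, rfl, rfl⟩ := hij
      refine h _ _ ⟨hi, hj, ?_⟩
      exact SimpleGraph.ConnectedComponent.exact (Eq.trans hic (Eq.symm hjc))

theorem edgeIdeal_le_primeIdeal (T : Set V) : edgeIdeal K G ≤ primeIdeal K G T := by
  obtain ⟨h1, h2⟩ := primeIdeal_le_iff.1 (le_refl (primeIdeal K G T))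
  refine edgeIdeal_le_iff.2 fun i j hij => ?_
  by_cases hi : i ∈ T
  · exact sub_mem (Ideal.mul_mem_right _ _ (h1 i hi).1) (Ideal.mul_mem_left _ _ (h1 i hi).2)
  by_cases hj : j ∈ T
  · exact sub_mem (Ideal.mul_mem_left _ _ (h1 j hj).2) (Ideal.mul_mem_right _ _ (h1 j hj).1)
  exact h2 i j ⟨hi, hj, SimpleGraph.Adj.reachable hij⟩

/-- Being parallel is transitive through a nonzero vector. -/
theorem cross_eq_zero_trans {L : Type*} [CommRing L] [IsDomain L] {a b c d e f : L}
    (h : a * d - c * b = 0) (h' : c * f - e * d = 0) (hne : ¬(c = 0 ∧ d = 0)) :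
    a * f - e * b = 0 := by
  by_cases hc : c = 0
  · refine (mul_eq_zero.1 (?_ : d * (a * f - e * b) = 0)).resolve_left fun hd => hne ⟨hc, hd⟩
    linear_combination f * h + b * h'
  · refine (mul_eq_zero.1 (?_ : c * (a * f - e * b) = 0)).resolve_left hc
    linear_combination e * h + a * h'

/-- Pairwise parallel vectors in a plane lie on a common line. -/
theorem exists_common_line {L ι : Type*} [Field L] (u v : ι → L) (s : Set ι)
    (h : ∀ i ∈ s, ∀ j ∈ s, u i * v j - u j * v i = 0) :
    ∃ a b : L, ∀ i ∈ s, ∃ t : L, u i = t * a ∧ v i = t * b := by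
  by_cases hz : ∀ i ∈ s, u i = 0 ∧ v i = 0
  · exact ⟨0, 0, fun i hi => ⟨0, by simp [hz i hi]⟩⟩
  push Not at hz
  obtain ⟨k, hk, hne⟩ := hz
  refine ⟨u k, v k, fun i hi => ?_⟩
  have hik := h i hi k hk
  by_cases hu : u k = 0
  · have hv := hne hu
    refine ⟨v i / v k, ?_, by field_simp⟩
    have : u i * v k = 0 := by linear_combination hik + v i * hu
    rw [hu, mul_zero]
    exact (mul_eq_zero.1 this).resolve_right hv
  · refine ⟨u i / u k, by field_simp, ?_⟩
    field_simp
    linear_combination -hik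

theorem minor_mem_trans {R : Type*} [CommRing R] {Q : Ideal R} [Q.IsPrime] {a b c d e f : R}
    (h : a * d - c * b ∈ Q) (h' : c * f - e * d ∈ Q) (hne : ¬(c ∈ Q ∧ d ∈ Q)) :
    a * f - e * b ∈ Q := by
  rw [← Ideal.Quotient.eq_zero_iff_mem, map_sub, map_mul, map_mul] at h h' ⊢
  rw [← Ideal.Quotient.eq_zero_iff_mem, ← Ideal.Quotient.eq_zero_iff_mem] at hne
  exact cross_eq_zero_trans h h' hne

/-- Along a path avoiding `T` every vector (x_k, y_k) is nonzero modulo `Q`, so being parallel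
propagates. -/
theorem minor_mem_of_sameComponent {Q : Ideal (PolyRing K V)} [Q.IsPrime]
    (hQ : edgeIdeal K G ≤ Q) (hT : ∀ i ∉ T, ¬(x K i ∈ Q ∧ y K i ∈ Q)) {i j : V}
    (hij : SameComponent G T i j) : x K i * y K j - x K j * y K i ∈ Q := by
  refine hij.induction (P := fun k => x K i * y K k - x K k * y K i ∈ Q) ?_
    fun a b ha _ hab ih => ?_
  · rw [sub_self]; exact Q.zero_mem
  · exact minor_mem_trans ih (edgeIdeal_le_iff.1 hQ a b hab) (hT a ha)

/-- A prime containing the edge ideal contains `P_T`, with `T` the set of vertices both of whose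
variables it contains. -/
theorem exists_primeIdeal_le_of_edgeIdeal_le {Q : Ideal (PolyRing K V)} [Q.IsPrime]
    (hQ : edgeIdeal K G ≤ Q) : ∃ T, primeIdeal K G T ≤ Q :=
  ⟨{i | x K i ∈ Q ∧ y K i ∈ Q}, primeIdeal_le_iff.2
    ⟨fun _ hi => hi, fun _ _ hij => minor_mem_of_sameComponent hQ (fun _ hi => hi) hij⟩⟩

theorem primeIdeal_le_ker_param {r : V → V} {N T' : Finset V} (hT : (T' : Set V) = T)
    (hN : ∀ i ∉ T, blockLabel r N i = r i) (hr : ∀ i j, SameComponent G T i j → r i = r j) :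
    primeIdeal K G T ≤ (paramPrime K r N T' T').asIdeal := by
  classical
  have hmem : ∀ i, i ∈ T' ↔ i ∈ T := fun i => by rw [← hT, Finset.mem_coe]
  refine primeIdeal_le_iff.2 ⟨fun i hi => ⟨?_, ?_⟩, fun i j hij => ?_⟩
  · change param K r N T' T' _ = 0
    simp [param_x, hmem, hi]
  · change param K r N T' T' _ = 0
    simp [param_y, hmem, hi]
  · change param K r N T' T' _ = 0
    have h := hr i j hij
    obtain ⟨hi, hj, -⟩ := hij
    simp only [map_sub, map_mul, param_x, param_y, hmem, hi, hj, hN i hi, hN j hj, h]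
    split_ifs <;> ring

/-- Over the fraction field of the quotient by `Q`, the vectors (x_i, y_i) of one component lie on a
common line. Coordinates on these lines give values for s, a, b, so the map to that field factors
through `param`. -/
theorem ker_param_le_of_primeIdeal_le {Q : Ideal (PolyRing K V)} [Q.IsPrime]
    {r : V → V} {N T' : Finset V} (hT : (T' : Set V) = T)
    (hN : ∀ i ∉ T, blockLabel r N i = r i) (hr : ∀ i ∉ T, SameComponent G T (r i) i)
    (hQ : primeIdeal K G T ≤ Q) : (paramPrime K r N T' T').asIdeal ≤ Q := by
  classical
  have hmem : ∀ i, i ∈ T' ↔ i ∈ T := fun i => by rw [← hT, Finset.mem_coe]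
  obtain ⟨h1, h2⟩ := primeIdeal_le_iff.1 hQ
  let L := FractionRing (PolyRing K V ⧸ Q)
  let g : PolyRing K V →ₐ[K] L :=
    (IsScalarTower.toAlgHom K (PolyRing K V ⧸ Q) L).comp (Ideal.Quotient.mkₐ K Q)
  have hg : ∀ f, g f = 0 ↔ f ∈ Q := by
    intro f
    rw [← Ideal.Quotient.eq_zero_iff_mem]
    exact (IsFractionRing.injective (PolyRing K V ⧸ Q) L).eq_iff' (map_zero _)
  have hline : ∀ c : V, ∃ a b : L, ∀ i ∈ {i | i ∉ T ∧ r i = c},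
      ∃ t : L, g (x K i) = t * a ∧ g (y K i) = t * b := by
    intro c
    refine exists_common_line _ _ _ fun i hi j hj => ?_
    obtain ⟨hi', hri, hi''⟩ := hr i hi.1
    obtain ⟨hj', hrj, hj''⟩ := hr j hj.1
    have := h2 i j ⟨hri, hrj, hi''.symm.trans (by
      have e : (⟨r i, hi'⟩ : (Tᶜ : Set V)) = ⟨r j, hj'⟩ := Subtype.ext (hi.2.trans hj.2.symm)
      rw [e]; exact hj'')⟩
    rw [← hg] at this
    simpa using this
  choose a b ht using hline
  have ht' : ∀ i : V, ∃ t : L, i ∉ T → g (x K i) = t * a (r i) ∧ g (y K i) = t * b (r i) := by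
    intro i
    by_cases hi : i ∈ T
    · exact ⟨0, fun h => absurd hi h⟩
    · obtain ⟨t, h⟩ := ht (r i) i ⟨hi, rfl⟩
      exact ⟨t, fun _ => h⟩
  choose s hs using ht'
  let ev : MvPolynomial (Fin 3 × V) K →ₐ[K] L :=
    aeval fun p => if p.1 = 0 then s p.2 else if p.1 = 1 then a p.2 else b p.2
  have hrT : ∀ i ∉ T, r i ∉ T := fun i hi => (hr i hi).1
  have hfac : ev.comp (param K r N T' T') = g := by
    refine algHom_ext_xy (fun i => ?_) fun i => ?_
    · by_cases hi : i ∈ T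
      · simp [param_x, hmem, hi, (hg _).2 (h1 i hi).1]
      · simp [param_x, hmem, hi, hN i hi, (hs i hi).1, ev]
    · by_cases hi : i ∈ T
      · simp [param_y, hmem, hi, (hg _).2 (h1 i hi).2]
      · simp [param_y, hmem, hi, hN i hi, (hs i hi).2, ev, hrT i hi]
  intro f hf
  rw [← hg, ← hfac, AlgHom.comp_apply, show param K r N T' T' f = 0 from hf, map_zero]

/-- An ideal whose radical is the prime `q` has the height and the coheight of `q`. -/
theorem height_eq_and_ringKrullDim_quotient_eq {R : Type*} [CommRing R] {I : Ideal R}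
    {q : PrimeSpectrum R} (hle : I ≤ q.asIdeal)
    (hmin : ∀ p : Ideal R, p.IsPrime → I ≤ p → q.asIdeal ≤ p) :
    I.height = Order.height q ∧ ringKrullDim (R ⧸ I) = Order.coheight q := by
  constructor
  · rw [← PrimeSpectrum.height_eq_orderHeight]
    refine le_antisymm (Ideal.height_mono hle) ?_
    rw [I.height_eq_inf_minimalPrimes]
    exact le_iInf₂ fun J hJ => Ideal.height_mono (hmin J hJ.1.1 hJ.1.2)
  · rw [ringKrullDim_quotient, Order.coheight_eq_krullDim_Ici]
    have : PrimeSpectrum.zeroLocus (I : Set R) = Set.Ici q := by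
      ext p
      rw [PrimeSpectrum.mem_zeroLocus, Set.mem_Ici, ← PrimeSpectrum.asIdeal_le_asIdeal]
      exact ⟨fun h => hmin _ p.2 h, fun h => hle.trans h⟩
    rw [this]

variable (K G) in
/-- The height of `P_T(G)` is `|T| + n - c(T)` and its dimension is `n - |T| + c(T)`. -/
theorem exists_height_primeIdeal_eq [Fintype V] (T : Set V) :
    ∃ h d : ℕ, (primeIdeal K G T).height = h ∧
      ringKrullDim (PolyRing K V ⧸ primeIdeal K G T) = (d : WithBot ℕ∞) ∧
      h + numComponents G T = T.ncard + Fintype.card V ∧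
      d + T.ncard = Fintype.card V + numComponents G T := by
  classical
  obtain ⟨r, hr, hr', hcard⟩ := exists_representative G T
  have hrr : ∀ i ∉ T, r (r i) = r i := fun i hi => hr' _ _ (hr i hi)
  let T' : Finset V := T.toFinset
  -- `C` holds one representative per component and `N` the other surviving vertices, so |C| = c(T)
  -- and |N| = n - |T| - c(T).
  let N : Finset V := {i | i ∉ T ∧ r i ≠ i}
  let C : Finset V := {i | i ∉ T ∧ r i = i}
  have hT : (T' : Set V) = T := by simp [T']
  have hTc : T'.card = T.ncard := by rw [← Set.ncard_coe_finset, hT]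
  have hCc : C.card = numComponents G T := by
    rw [← hcard, ← Set.ncard_coe_finset]; simp [C]
  have hN : ∀ i ∉ T, blockLabel r N i = r i := by
    intro i hi
    by_cases h : r i = i <;> simp [blockLabel, N, hi, h]
  have hsum : T'.card + N.card + C.card = Fintype.card V := by
    have h1 : T'.card + (Finset.univ.filter fun i => i ∉ T).card = Fintype.card V := by
      rw [← Finset.card_univ, ← Finset.card_filter_add_card_filter_not (s := Finset.univ) (· ∈ T)]
      congr 2
      ext; simp [T']
    have h2 := Finset.card_filter_add_card_filter_not
      (s := Finset.univ.filter fun i => i ∉ T) (fun i => r i = i)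
    rw [Finset.filter_filter, Finset.filter_filter] at h2
    change C.card + N.card = _ at h2
    omega
  obtain ⟨hh, hd⟩ := height_paramPrime_and_coheight_paramPrime (K := K) (r := r) (T := T') (N := N)
    (C := C) (by
      intro i hi
      simp only [N, T', Finset.mem_filter, Finset.mem_univ, true_and, Set.mem_toFinset] at hi ⊢
      exact ⟨hi.1, (hr i hi.1).1, fun h => h.2 (hrr i hi.1)⟩)
    (Finset.disjoint_left.2 fun i hi hi' => by simp_all [C, N])
    (Finset.disjoint_left.2 fun i hi hi' => by simp_all [C, T']) hsum
  obtain ⟨e1, e2⟩ := height_eq_and_ringKrullDim_quotient_eq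
    (primeIdeal_le_ker_param (K := K) (G := G) hT hN hr')
    (fun p hp hle => ker_param_le_of_primeIdeal_le hT hN hr hle)
  refine ⟨_, _, e1.trans hh, e2.trans (congrArg _ hd), ?_, ?_⟩ <;> omega

/-- The dimension of a quotient is bounded by the dimensions of the closed sets covering it. -/
theorem ringKrullDim_quotient_le_of_forall {R : Type*} [CommRing R] {I : Ideal R}
    {d : WithBot ℕ∞}
    (h : ∀ p : Ideal R, p.IsPrime → I ≤ p → ∃ J ≤ p, ringKrullDim (R ⧸ J) ≤ d) :
    ringKrullDim (R ⧸ I) ≤ d := by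
  rw [ringKrullDim_quotient]
  refine iSup_le fun s => ?_
  -- An ideal below the smallest prime of the chain lies below all of them, so the whole chain lives
  -- in one closed set.
  obtain ⟨J, hJ, hd⟩ := h s.head.1.asIdeal s.head.1.2 s.head.2
  refine le_trans ?_ hd
  rw [ringKrullDim_quotient]
  let s' : LTSeries (PrimeSpectrum.zeroLocus (J : Set R)) :=
    { length := s.length
      toFun := fun k => ⟨(s k).1, hJ.trans (show s.head ≤ s k from s.head_le k)⟩
      step := fun k => s.step k }
  exact Order.LTSeries.length_le_krullDim s'

end Ideals

end BinomialEdge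
namespace BinomialEdge

/-! ### Cut sets in terms of component counts -/

section CutSets

variable {V : Type*} (G : SimpleGraph V)

theorem numComponents_univ : numComponents G Set.univ = 0 := by
  have : IsEmpty (G.induce (Set.univᶜ : Set V)).ConnectedComponent :=
    ⟨fun c => c.out.2 trivial⟩
  exact Nat.card_of_isEmpty

theorem numComponents_pos [Finite V] {T : Set V} {i : V} (hi : i ∉ T) : 0 < numComponents G T := by
  have : Nonempty (G.induce Tᶜ).ConnectedComponent :=
    ⟨(G.induce Tᶜ).connectedComponentMk ⟨i, hi⟩⟩
  exact Nat.card_pos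

theorem numComponents_eq_one {T : Set V} (h : (G.induce Tᶜ).Connected) :
    numComponents G T = 1 := by
  have := h.preconnected.subsingleton_connectedComponent
  have := h.nonempty
  have : Nonempty (G.induce Tᶜ).ConnectedComponent := inferInstance
  exact Nat.card_eq_one_iff_unique.2 ⟨inferInstance, inferInstance⟩

theorem numComponents_empty (h : G.Connected) : numComponents G ∅ = 1 := by
  refine numComponents_eq_one G ?_
  rw [Set.compl_empty]
  exact (SimpleGraph.induceUnivIso G).connected_iff.2 h

/-- Deleting `i` from the graph induced on `Tᶜ ∪ {i}` gives the graph induced on `Tᶜ`, so only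
component counts matter. -/
theorem hasCutPointProperty_iff {T : Set V} :
    HasCutPointProperty G T ↔ ∀ i ∈ T, numComponents G (T \ {i}) < numComponents G T := by
  refine forall₂_congr fun i hi => ?_
  have h1 : Nat.card (G.induce (Tᶜ ∪ {i})).ConnectedComponent = numComponents G (T \ {i}) := by
    rw [numComponents, Set.sdiff_eq, Set.compl_inter, compl_compl]
  let e : (G.induce (Tᶜ ∪ {i})).induce ({⟨i, Or.inr rfl⟩}ᶜ : Set (Tᶜ ∪ {i} : Set V)) ≃g
      G.induce Tᶜ :=
    { toFun := fun v => ⟨v.1.1, v.1.2.resolve_right fun h => v.2 (Subtype.ext h)⟩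
      invFun := fun v => ⟨⟨v.1, Or.inl v.2⟩, fun h => v.2 (by
        have : v.1 = i := congrArg Subtype.val h
        rwa [this])⟩
      left_inv := fun _ => rfl
      right_inv := fun _ => rfl
      map_rel_iff' := Iff.rfl }
  rw [IsCutPoint, h1, Nat.card_congr e.connectedComponentEquiv]
  rfl

theorem mem_cutSetsBar_iff {T : Set V} : T ∈ cutSetsBar G ↔
    T.Nonempty ∧ ∀ i ∈ T, numComponents G (T \ {i}) < numComponents G T := by
  rw [cutSetsBar, cutSets, ← hasCutPointProperty_iff, Set.nonempty_iff_ne_empty]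
  simp only [Set.mem_sdiff, Set.mem_union, Set.mem_singleton_iff, Set.mem_ofPred_eq]
  tauto

theorem empty_mem_cutSets : ∅ ∈ cutSets G := Or.inl rfl

theorem cutSets_eq : cutSets G = {∅} ∪ cutSetsBar G := by
  rw [cutSetsBar, Set.union_sdiff_self, Set.union_eq_right.2]
  exact Set.singleton_subset_iff.2 (empty_mem_cutSets G)

end CutSets

/-! ### Height and dimension of J_G from cut sets -/

section EdgeIdeal

variable (K : Type*) [Field K] {V : Type*} (G : SimpleGraph V)

theorem height_edgeIdeal_le (T : Set V) :
    (edgeIdeal K G).height ≤ (primeIdeal K G T).height :=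
  Ideal.height_mono (edgeIdeal_le_primeIdeal T)

theorem ringKrullDim_primeIdeal_le (T : Set V) :
    ringKrullDim (PolyRing K V ⧸ primeIdeal K G T) ≤
      ringKrullDim (PolyRing K V ⧸ edgeIdeal K G) :=
  ringKrullDim_le_of_surjective (Ideal.Quotient.factor (edgeIdeal_le_primeIdeal T))
    (Ideal.Quotient.factor_surjective _)

variable [Fintype V]

/-- Removing vertices that are not cut points decreases the height and increases the dimension. -/
theorem exists_cutSet_height_le (T : Set V) :
    ∃ T' ∈ cutSets G, (primeIdeal K G T').height ≤ (primeIdeal K G T).height ∧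
      ringKrullDim (PolyRing K V ⧸ primeIdeal K G T) ≤
        ringKrullDim (PolyRing K V ⧸ primeIdeal K G T') := by
  induction hn : T.ncard using Nat.strong_induction_on generalizing T with
  | _ n ih =>
    by_cases hT : T ∈ cutSets G
    · exact ⟨T, hT, le_rfl, le_rfl⟩
    have hT' : ¬HasCutPointProperty G T := fun h => hT (Or.inr h)
    rw [hasCutPointProperty_iff] at hT'
    push Not at hT'
    obtain ⟨i, hi, hle⟩ := hT'
    have hcard := Set.ncard_sdiff_singleton_add_one hi
    -- Passing to `T \ {i}` lowers |T| by one and does not lower c(T), so both inequalities follow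
    -- from the formulas.
    obtain ⟨T', hT', h1, h2⟩ := ih (T \ {i}).ncard (by omega) (T \ {i}) rfl
    obtain ⟨h, d, eh, ed, hh, hd⟩ := exists_height_primeIdeal_eq K G T
    obtain ⟨h', d', eh', ed', hh', hd'⟩ := exists_height_primeIdeal_eq K G (T \ {i})
    refine ⟨T', hT', h1.trans ?_, le_trans ?_ h2⟩
    · rw [eh, eh']; exact_mod_cast (by omega : h' ≤ h)
    · rw [ed, ed']; exact_mod_cast (by omega : d ≤ d')

theorem exists_cutSet_height_eq :
    ∃ T ∈ cutSets G, (edgeIdeal K G).height = (primeIdeal K G T).height := by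
  obtain ⟨h, -, eh, -⟩ := exists_height_primeIdeal_eq K G ∅
  -- Finiteness of the height is what provides a prime over the ideal attaining it.
  have hlt : (edgeIdeal K G).height ≠ ⊤ :=
    ne_top_of_le_ne_top (eh ▸ ENat.natCast_ne_top h) (height_edgeIdeal_le K G ∅)
  obtain ⟨n, hn⟩ := ENat.ne_top_iff_exists.1 hlt
  obtain ⟨Q, hQ, hle, hQn⟩ := Ideal.exists_isPrime_height_eq hn.symm
  obtain ⟨T, hT⟩ := exists_primeIdeal_le_of_edgeIdeal_le hle
  obtain ⟨T', hT', h1, -⟩ := exists_cutSet_height_le K G T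
  refine ⟨T', hT', le_antisymm (height_edgeIdeal_le K G T') ?_⟩
  rw [← hn, ← hQn]
  exact h1.trans (Ideal.height_mono hT)

theorem exists_cutSet_ringKrullDim_eq :
    ∃ T ∈ cutSets G, ringKrullDim (PolyRing K V ⧸ edgeIdeal K G) =
      ringKrullDim (PolyRing K V ⧸ primeIdeal K G T) := by
  obtain ⟨T, hT, hmax⟩ := Set.exists_max_image (cutSets G)
    (fun T => ringKrullDim (PolyRing K V ⧸ primeIdeal K G T)) (Set.toFinite _)
    ⟨∅, empty_mem_cutSets G⟩
  refine ⟨T, hT, le_antisymm ?_ (ringKrullDim_primeIdeal_le K G T)⟩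
  refine ringKrullDim_quotient_le_of_forall fun Q hQ hle => ?_
  obtain ⟨T₀, hT₀⟩ := exists_primeIdeal_le_of_edgeIdeal_le hle
  obtain ⟨T', hT', -, h2⟩ := exists_cutSet_height_le K G T₀
  exact ⟨_, hT₀, h2.trans (hmax T' hT')⟩

end EdgeIdeal

/-! ### Cut sets of a join -/

section Join

variable {V₁ V₂ : Type*} (G₁ : SimpleGraph V₁) (G₂ : SimpleGraph V₂)

theorem numComponents_join_eq_one {T : Set (V₁ ⊕ V₂)} {v : V₁} {w : V₂} (hv : Sum.inl v ∉ T)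
    (hw : Sum.inr w ∉ T) : numComponents (join G₁ G₂) T = 1 := by
  refine numComponents_eq_one _ ?_
  have hvw : ((join G₁ G₂).induce Tᶜ).Adj ⟨.inl v, hv⟩ ⟨.inr w, hw⟩ := trivial
  refine SimpleGraph.connected_iff_exists_forall_reachable _ |>.2 ⟨⟨.inl v, hv⟩, ?_⟩
  rintro ⟨u | u, hu⟩
  · have : ((join G₁ G₂).induce Tᶜ).Adj ⟨.inr w, hw⟩ ⟨.inl u, hu⟩ := trivial
    exact hvw.reachable.trans this.reachable
  · have : ((join G₁ G₂).induce Tᶜ).Adj ⟨.inl v, hv⟩ ⟨.inr u, hu⟩ := trivial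
    exact this.reachable

theorem numComponents_join_inl (A : Set V₁) :
    numComponents (join G₁ G₂) (Sum.inl '' A ∪ Set.range Sum.inr) = numComponents G₁ A := by
  let f : (Aᶜ : Set V₁) → ((Sum.inl '' A ∪ Set.range Sum.inr)ᶜ : Set (V₁ ⊕ V₂)) :=
    fun v => ⟨.inl v.1, by
      have hv : v.1 ∉ A := v.2
      simpa only [Set.mem_compl_iff, Set.mem_union, Set.mem_image, Set.mem_range, Sum.inl.injEq,
        exists_eq_right, reduceCtorEq, exists_false, or_false] using hv⟩
  have hf : Function.Bijective f := by
    refine ⟨fun v w h => Subtype.ext (Sum.inl_injective (congrArg Subtype.val h)), ?_⟩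
    rintro ⟨u | u, hu⟩
    · exact ⟨⟨u, by simpa using hu⟩, rfl⟩
    · exact absurd (Or.inr ⟨u, rfl⟩) hu
  let e : G₁.induce Aᶜ ≃g (join G₁ G₂).induce (Sum.inl '' A ∪ Set.range Sum.inr)ᶜ :=
    { Equiv.ofBijective f hf with map_rel_iff' := Iff.rfl }
  exact (Nat.card_congr e.connectedComponentEquiv).symm

theorem numComponents_join_inr (B : Set V₂) :
    numComponents (join G₁ G₂) (Sum.inr '' B ∪ Set.range Sum.inl) = numComponents G₂ B := by
  let f : (Bᶜ : Set V₂) → ((Sum.inr '' B ∪ Set.range Sum.inl)ᶜ : Set (V₁ ⊕ V₂)) :=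
    fun v => ⟨.inr v.1, by
      have hv : v.1 ∉ B := v.2
      simpa only [Set.mem_compl_iff, Set.mem_union, Set.mem_image, Set.mem_range, Sum.inr.injEq,
        exists_eq_right, reduceCtorEq, exists_false, or_false] using hv⟩
  have hf : Function.Bijective f := by
    refine ⟨fun v w h => Subtype.ext (Sum.inr_injective (congrArg Subtype.val h)), ?_⟩
    rintro ⟨u | u, hu⟩
    · exact absurd (Or.inr ⟨u, rfl⟩) hu
    · exact ⟨⟨u, by simpa using hu⟩, rfl⟩
  let e : G₂.induce Bᶜ ≃g (join G₁ G₂).induce (Sum.inr '' B ∪ Set.range Sum.inl)ᶜ :=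
    { Equiv.ofBijective f hf with map_rel_iff' := Iff.rfl }
  exact (Nat.card_congr e.connectedComponentEquiv).symm

theorem numComponents_join_empty [Nonempty V₁] [Nonempty V₂] :
    numComponents (join G₁ G₂) ∅ = 1 :=
  numComponents_join_eq_one G₁ G₂ (v := Classical.arbitrary V₁) (w := Classical.arbitrary V₂)
    (Set.notMem_empty _) (Set.notMem_empty _)

theorem image_inl_union_diff (A : Set V₁) (i : V₁) :
    (Sum.inl '' A ∪ Set.range Sum.inr : Set (V₁ ⊕ V₂)) \ {Sum.inl i} =
      Sum.inl '' (A \ {i}) ∪ Set.range Sum.inr := by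
  ext (v | v) <;> simp

theorem image_inr_union_diff (B : Set V₂) (i : V₂) :
    (Sum.inr '' B ∪ Set.range Sum.inl : Set (V₁ ⊕ V₂)) \ {Sum.inr i} =
      Sum.inr '' (B \ {i}) ∪ Set.range Sum.inl := by
  ext (v | v) <;> simp

variable [Finite V₁] [Finite V₂]

/-- Restoring one `i ∈ T` leaves at least one component, and deleting it again strictly increases
the count. -/
theorem one_lt_numComponents_of_mem_cutSetsBar {V : Type*} [Finite V] {G : SimpleGraph V}
    {T : Set V} (hT : T ∈ cutSetsBar G) : 1 < numComponents G T := by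
  rw [mem_cutSetsBar_iff] at hT
  obtain ⟨⟨i, hi⟩, h⟩ := hT
  have h1 := h i hi
  have h2 : 0 < numComponents G (T \ {i}) := numComponents_pos G (i := i) (by simp)
  omega

theorem exists_notMem_of_mem_cutSetsBar {V : Type*} [Finite V] {G : SimpleGraph V}
    {T : Set V} (hT : T ∈ cutSetsBar G) : ∃ i, i ∉ T := by
  by_contra! h
  have := one_lt_numComponents_of_mem_cutSetsBar hT
  rw [Set.eq_univ_of_forall h, numComponents_univ] at this
  omega

theorem inl_mem_cutSetsBar_join (h₁ : G₁.Connected) (A : Set V₁) :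
    Sum.inl '' A ∪ Set.range Sum.inr ∈ cutSetsBar (join G₁ G₂) ↔ A ∈ cutSetsBar G₁ := by
  constructor
  · intro h
    have h' := one_lt_numComponents_of_mem_cutSetsBar h
    rw [mem_cutSetsBar_iff] at h ⊢
    rw [numComponents_join_inl] at h h'
    refine ⟨?_, fun i hi => ?_⟩
    · rw [Set.nonempty_iff_ne_empty]
      -- For empty `A` the remaining graph is `G₁`, which is connected; this contradicts having two
      -- components.
      rintro rfl
      rw [numComponents_empty G₁ h₁] at h'
      omega
    · have := h.2 (Sum.inl i) (Or.inl ⟨i, hi, rfl⟩)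
      rwa [image_inl_union_diff, numComponents_join_inl] at this
  · intro h
    have h' := one_lt_numComponents_of_mem_cutSetsBar h
    obtain ⟨v, hv⟩ := exists_notMem_of_mem_cutSetsBar h
    rw [mem_cutSetsBar_iff] at h ⊢
    rw [numComponents_join_inl]
    refine ⟨(h.1.image _).mono Set.subset_union_left, ?_⟩
    rintro (i | i) hi
    · rw [image_inl_union_diff, numComponents_join_inl]
      exact h.2 i (by simpa using hi)
    -- Restoring `i` from the second side next to the survivor `v` of the first makes the graph
    -- connected.
    · rw [numComponents_join_eq_one G₁ G₂ (v := v) (w := i) (by simpa using hv) (by simp)]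
      exact h'

theorem inr_mem_cutSetsBar_join (h₂ : G₂.Connected) (B : Set V₂) :
    Sum.inr '' B ∪ Set.range Sum.inl ∈ cutSetsBar (join G₁ G₂) ↔ B ∈ cutSetsBar G₂ := by
  constructor
  · intro h
    have h' := one_lt_numComponents_of_mem_cutSetsBar h
    rw [mem_cutSetsBar_iff] at h ⊢
    rw [numComponents_join_inr] at h h'
    refine ⟨?_, fun i hi => ?_⟩
    · rw [Set.nonempty_iff_ne_empty]
      rintro rfl
      rw [numComponents_empty G₂ h₂] at h'
      omega
    · have := h.2 (Sum.inr i) (Or.inl ⟨i, hi, rfl⟩)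
      rwa [image_inr_union_diff, numComponents_join_inr] at this
  · intro h
    have h' := one_lt_numComponents_of_mem_cutSetsBar h
    obtain ⟨v, hv⟩ := exists_notMem_of_mem_cutSetsBar h
    rw [mem_cutSetsBar_iff] at h ⊢
    rw [numComponents_join_inr]
    refine ⟨(h.1.image _).mono Set.subset_union_left, ?_⟩
    rintro (i | i) hi
    · rw [numComponents_join_eq_one G₁ G₂ (v := i) (w := v) (by simp) (by simpa using hv)]
      exact h'
    · rw [image_inr_union_diff, numComponents_join_inr]
      exact h.2 i (by simpa using hi)

theorem mem_cutSetsBar_join_iff (h₁ : G₁.Connected) (h₂ : G₂.Connected) (T : Set (V₁ ⊕ V₂)) :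
    T ∈ cutSetsBar (join G₁ G₂) ↔
      (∃ A ∈ cutSetsBar G₁, Sum.inl '' A ∪ Set.range Sum.inr = T) ∨
      ∃ B ∈ cutSetsBar G₂, Sum.inr '' B ∪ Set.range Sum.inl = T := by
  constructor
  · intro h
    by_cases hr : ∀ w, Sum.inr w ∈ T
    · have hT : Sum.inl '' (Sum.inl ⁻¹' T) ∪ Set.range Sum.inr = T := by
        ext (v | v) <;> simp [hr]
      exact Or.inl ⟨_, (inl_mem_cutSetsBar_join G₁ G₂ h₁ _).1 (hT.symm ▸ h), hT⟩
    by_cases hl : ∀ v, Sum.inl v ∈ T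
    · have hT : Sum.inr '' (Sum.inr ⁻¹' T) ∪ Set.range Sum.inl = T := by
        ext (v | v) <;> simp [hl]
      exact Or.inr ⟨_, (inr_mem_cutSetsBar_join G₁ G₂ h₂ _).1 (hT.symm ▸ h), hT⟩
    push Not at hr hl
    obtain ⟨w, hw⟩ := hr
    obtain ⟨v, hv⟩ := hl
    have := one_lt_numComponents_of_mem_cutSetsBar h
    rw [numComponents_join_eq_one G₁ G₂ hv hw] at this
    omega
  · rintro (⟨A, hA, rfl⟩ | ⟨B, hB, rfl⟩)
    · exact (inl_mem_cutSetsBar_join G₁ G₂ h₁ A).2 hA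
    · exact (inr_mem_cutSetsBar_join G₁ G₂ h₂ B).2 hB

theorem cutSets_join (h₁ : G₁.Connected) (h₂ : G₂.Connected) :
    cutSets (join G₁ G₂) = {∅} ∪
      familyJoin (Set.image Sum.inl '' cutSetsBar G₁) {Set.range Sum.inr} ∪
      familyJoin (Set.image Sum.inr '' cutSetsBar G₂) {Set.range Sum.inl} := by
  rw [cutSets_eq, Set.union_assoc]
  congr 1
  ext T
  rw [mem_cutSetsBar_join_iff G₁ G₂ h₁ h₂]
  simp [familyJoin]

end Join

/-! ### Numerical invariants of P_T in a join -/

section JoinDimension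

variable (K : Type*) [Field K] {V₁ V₂ : Type*} [Fintype V₁] [Fintype V₂]
  (G₁ : SimpleGraph V₁) (G₂ : SimpleGraph V₂)

/-- Both |T| and n grow by |V₂| while c(T) is unchanged: the height gains 2|V₂| and the increments
cancel in the dimension. -/
theorem primeIdeal_join_inl (A : Set V₁) :
    (primeIdeal K (join G₁ G₂) (Sum.inl '' A ∪ Set.range Sum.inr)).height =
        (primeIdeal K G₁ A).height + 2 * (Fintype.card V₂ : ℕ∞) ∧
      ringKrullDim (PolyRing K (V₁ ⊕ V₂) ⧸
          primeIdeal K (join G₁ G₂) (Sum.inl '' A ∪ Set.range Sum.inr)) =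
        ringKrullDim (PolyRing K V₁ ⧸ primeIdeal K G₁ A) := by
  obtain ⟨h, d, eh, ed, hh, hd⟩ := exists_height_primeIdeal_eq K G₁ A
  obtain ⟨h', d', eh', ed', hh', hd'⟩ := exists_height_primeIdeal_eq K (join G₁ G₂)
    (Sum.inl '' A ∪ Set.range Sum.inr)
  have hcard : (Sum.inl '' A ∪ Set.range Sum.inr : Set (V₁ ⊕ V₂)).ncard =
      A.ncard + Fintype.card V₂ := by
    rw [Set.ncard_union_eq (Set.disjoint_left.2 (by rintro _ ⟨a, -, rfl⟩ ⟨b, hb⟩; cases hb)),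
      Set.ncard_image_of_injective _ Sum.inl_injective, ← Set.image_univ,
      Set.ncard_image_of_injective _ Sum.inr_injective, Set.ncard_univ, Nat.card_eq_fintype_card]
  rw [numComponents_join_inl, hcard, Fintype.card_sum] at hh' hd'
  rw [eh, ed, eh', ed']
  constructor
  · exact_mod_cast (by omega : h' = h + 2 * Fintype.card V₂)
  · exact_mod_cast (by omega : d' = d)

theorem primeIdeal_join_inr (B : Set V₂) :
    (primeIdeal K (join G₁ G₂) (Sum.inr '' B ∪ Set.range Sum.inl)).height =
        (primeIdeal K G₂ B).height + 2 * (Fintype.card V₁ : ℕ∞) ∧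
      ringKrullDim (PolyRing K (V₁ ⊕ V₂) ⧸
          primeIdeal K (join G₁ G₂) (Sum.inr '' B ∪ Set.range Sum.inl)) =
        ringKrullDim (PolyRing K V₂ ⧸ primeIdeal K G₂ B) := by
  obtain ⟨h, d, eh, ed, hh, hd⟩ := exists_height_primeIdeal_eq K G₂ B
  obtain ⟨h', d', eh', ed', hh', hd'⟩ := exists_height_primeIdeal_eq K (join G₁ G₂)
    (Sum.inr '' B ∪ Set.range Sum.inl)
  have hcard : (Sum.inr '' B ∪ Set.range Sum.inl : Set (V₁ ⊕ V₂)).ncard =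
      B.ncard + Fintype.card V₁ := by
    rw [Set.ncard_union_eq (Set.disjoint_left.2 (by rintro _ ⟨a, -, rfl⟩ ⟨b, hb⟩; cases hb)),
      Set.ncard_image_of_injective _ Sum.inr_injective, ← Set.image_univ,
      Set.ncard_image_of_injective _ Sum.inl_injective, Set.ncard_univ, Nat.card_eq_fintype_card]
  rw [numComponents_join_inr, hcard, Fintype.card_sum] at hh' hd'
  rw [eh, ed, eh', ed']
  constructor
  · exact_mod_cast (by omega : h' = h + 2 * Fintype.card V₁)
  · exact_mod_cast (by omega : d' = d)

theorem primeIdeal_join_empty [Nonempty V₁] [Nonempty V₂] :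
    (primeIdeal K (join G₁ G₂) ∅).height = (Fintype.card V₁ + Fintype.card V₂ - 1 : ℕ) ∧
      ringKrullDim (PolyRing K (V₁ ⊕ V₂) ⧸ primeIdeal K (join G₁ G₂) ∅) =
        ((Fintype.card V₁ + Fintype.card V₂ + 1 : ℕ) : WithBot ℕ∞) := by
  obtain ⟨h, d, eh, ed, hh, hd⟩ := exists_height_primeIdeal_eq K (join G₁ G₂) ∅
  rw [numComponents_join_empty, Set.ncard_empty, Fintype.card_sum] at hh hd
  rw [eh, ed]
  constructor
  · congr 1; omega
  · congr 2

end JoinDimension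

end BinomialEdge

theorem proposition4p1 (K : Type*) [Field K] {V₁ V₂ : Type*} [Fintype V₁] [Fintype V₂]
    (G₁ : SimpleGraph V₁) (G₂ : SimpleGraph V₂) (h₁ : G₁.Connected) (h₂ : G₂.Connected) :
    (BinomialEdge.cutSets (BinomialEdge.join G₁ G₂) =
      {∅} ∪
      BinomialEdge.familyJoin (Set.image Sum.inl '' BinomialEdge.cutSetsBar G₁) {Set.range Sum.inr} ∪
      BinomialEdge.familyJoin (Set.image Sum.inr '' BinomialEdge.cutSetsBar G₂) {Set.range Sum.inl}) ∧
    IsLeast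
      ({h : ℕ∞ | ∃ T₁ ∈ BinomialEdge.cutSetsBar G₁,
          h = (BinomialEdge.primeIdeal K G₁ T₁).height + 2 * (Fintype.card V₂ : ℕ∞)} ∪
        {h : ℕ∞ | ∃ T₂ ∈ BinomialEdge.cutSetsBar G₂,
          h = (BinomialEdge.primeIdeal K G₂ T₂).height + 2 * (Fintype.card V₁ : ℕ∞)} ∪
        {((Fintype.card V₁ + Fintype.card V₂ - 1 : ℕ) : ℕ∞)})
      (BinomialEdge.edgeIdeal K (BinomialEdge.join G₁ G₂)).height ∧
    IsGreatest
      ({d : WithBot ℕ∞ | ∃ T₁ ∈ BinomialEdge.cutSetsBar G₁,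
          d = ringKrullDim (BinomialEdge.PolyRing K V₁ ⧸ BinomialEdge.primeIdeal K G₁ T₁)} ∪
        {d : WithBot ℕ∞ | ∃ T₂ ∈ BinomialEdge.cutSetsBar G₂,
          d = ringKrullDim (BinomialEdge.PolyRing K V₂ ⧸ BinomialEdge.primeIdeal K G₂ T₂)} ∪
        {((Fintype.card V₁ + Fintype.card V₂ + 1 : ℕ) : WithBot ℕ∞)})
      (ringKrullDim (BinomialEdge.PolyRing K (V₁ ⊕ V₂) ⧸
        BinomialEdge.edgeIdeal K (BinomialEdge.join G₁ G₂))) := by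
  have := h₁.nonempty
  have := h₂.nonempty
  have e0 := BinomialEdge.primeIdeal_join_empty K G₁ G₂
  have e1 := BinomialEdge.primeIdeal_join_inl K G₁ G₂
  have e2 := BinomialEdge.primeIdeal_join_inr K G₁ G₂
  have hcut : ∀ T ∈ BinomialEdge.cutSets (BinomialEdge.join G₁ G₂), T = ∅ ∨
      (∃ A ∈ BinomialEdge.cutSetsBar G₁, Sum.inl '' A ∪ Set.range Sum.inr = T) ∨
      ∃ B ∈ BinomialEdge.cutSetsBar G₂, Sum.inr '' B ∪ Set.range Sum.inl = T := by
    intro T hT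
    rw [BinomialEdge.cutSets_eq] at hT
    exact hT.imp id (BinomialEdge.mem_cutSetsBar_join_iff G₁ G₂ h₁ h₂ T).1
  refine ⟨BinomialEdge.cutSets_join G₁ G₂ h₁ h₂, ⟨?_, ?_⟩, ?_, ?_⟩
  · obtain ⟨T, hT, hh⟩ := BinomialEdge.exists_cutSet_height_eq K (BinomialEdge.join G₁ G₂)
    rw [hh]
    obtain rfl | ⟨A, hA, rfl⟩ | ⟨B, hB, rfl⟩ := hcut T hT
    · exact Or.inr e0.1
    · exact Or.inl (Or.inl ⟨A, hA, (e1 A).1⟩)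
    · exact Or.inl (Or.inr ⟨B, hB, (e2 B).1⟩)
  · rintro _ ((⟨A, -, rfl⟩ | ⟨B, -, rfl⟩) | rfl)
    · exact (e1 A).1 ▸ BinomialEdge.height_edgeIdeal_le K _ _
    · exact (e2 B).1 ▸ BinomialEdge.height_edgeIdeal_le K _ _
    · exact e0.1 ▸ BinomialEdge.height_edgeIdeal_le K _ _
  · obtain ⟨T, hT, hd⟩ := BinomialEdge.exists_cutSet_ringKrullDim_eq K (BinomialEdge.join G₁ G₂)
    rw [hd]
    obtain rfl | ⟨A, hA, rfl⟩ | ⟨B, hB, rfl⟩ := hcut T hT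
    · exact Or.inr e0.2
    · exact Or.inl (Or.inl ⟨A, hA, (e1 A).2⟩)
    · exact Or.inl (Or.inr ⟨B, hB, (e2 B).2⟩)
  · rintro _ ((⟨A, -, rfl⟩ | ⟨B, -, rfl⟩) | rfl)
    · exact (e1 A).2 ▸ BinomialEdge.ringKrullDim_primeIdeal_le K _ _
    · exact (e2 B).2 ▸ BinomialEdge.ringKrullDim_primeIdeal_le K _ _
    · exact e0.2 ▸ BinomialEdge.ringKrullDim_primeIdeal_le K _ _
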